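/- Let $G$ be a bipartite simple graph with vertex set $\{1,\dots,n\}$, let $L_G=D-A$ be its Laplacian matrix ($D$ the diagonal matrix of vertex degrees, $A$ the adjacency matrix), let $\lambda\vdash n$, and let $\chi_\lambda$ be the irreducible complex character of the symmetric group $\mathfrak S_n$ indexed by $\lambda$. For an $n\times n$ matrix $M=(m_{i,j})$ put $\mathrm{imm}_\lambda(M)=\sum_{\psi\in\mathfrak S_n}\chi_\lambda(\psi)\prod_{i=1}^n m_{i,\psi(i)}$, and for $0\le r\le n$ let $b_{\lambda,r}(L_G)$ be the coefficient of $(-1)^r x^{n-r}$ in the Laplacian immanantal polynomial $\mathrm{imm}_\lambda(xI-L_G)$. A graph $H$ is obtained from $G$ by a generalized graph shift (GGS) if there are two distinct vertices $u,v$ of $G$ and a path $P$ in $G$ from $u$ to $v$ such that every interior vertex of $P$ (if any) has degree $2$ in $G$, no cycle of $G$ contains both $u$ and $v$, and $H$ arises from $G$ by moving all neighbours of $v$, except its neighbour $w$ on $P$, to $u$; that is, for every neighbour $x\ne w$ of $v$ the edge $vx$ is deleted and the edge $ux$ is added. Then for every $\lambda\vdash n$ and every $0\le r\le n$, the number $b_{\lambda,r}(L_G)$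 is a non-negative integer, and for every graph $H$ obtained from $G$ by a GGS, $b_{\lambda,r}(L_H)$ is a non-negative integer with $b_{\lambda,r}(L_H)\le b_{\lambda,r}(L_G)$. -/

import Mathlib

open Polynomial

noncomputable section

/-! ### Irreducible characters of the symmetric group

The irreducible complex representation of the symmetric group attached to a partition `lam` is the
Specht module: the subspace of the space of formal complex combinations of tabloids of shape `lam`
that is spanned by the polytabloids. With this convention `(n)` gives the trivial character and
`1ⁿ` gives the sign character. -/

/-- The Young diagram of a partition: rows in weakly decreasing order of length. A cell is a pair
`(row, column)`. -/
def Nat.Partition.diagram {n : ℕ} (lam : n.Partition) : YoungDiagram :=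
  YoungDiagram.ofRowLens (lam.parts.sort (· ≥ ·)) (lam.parts.pairwise_sort (· ≥ ·)).sortedGE

/-- A Young tableau of shape `lam ⊢ n`: a bijective filling of the cells by the `n` letters. -/
structure YoungTableau {n : ℕ} (lam : n.Partition) where
  /-- The cell that contains a given letter. -/
  cell : Fin n ≃ lam.diagram.cells

namespace YoungTableau

variable {n : ℕ} {lam : n.Partition}

/-- The row in which the letter `i` stands. -/
def row (t : YoungTableau lam) (i : Fin n) : ℕ := (t.cell i : ℕ × ℕ).1

/-- The column in which the letter `i` stands. -/
def col (t : YoungTableau lam) (i : Fin n) : ℕ := (t.cell i : ℕ × ℕ).2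

/-- A permutation acts on a tableau by replacing each letter `i` by `σ i`. -/
instance instMulAction : MulAction (Equiv.Perm (Fin n)) (YoungTableau lam) where
  smul σ t := ⟨σ.symm.trans t.cell⟩
  one_smul _ := rfl
  mul_smul _ _ _ := rfl

/-- Two tableaux are row equivalent if each letter stands in the same row in both. -/
def rowSetoid (lam : n.Partition) : Setoid (YoungTableau lam) where
  r t t' := ∀ i, t.row i = t'.row i
  iseqv := ⟨fun _ _ => rfl, fun h i => (h i).symm, fun h h' i => (h i).trans (h' i)⟩

/-- The column stabilizer of a tableau. -/
def IsColumnPerm (t : YoungTableau lam) (σ : Equiv.Perm (Fin n)) : Prop :=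
  ∀ i, t.col (σ i) = t.col i

end YoungTableau

/-- Tabloids of shape `lam`: row equivalence classes of tableaux. -/
def Tabloid {n : ℕ} (lam : n.Partition) : Type := Quotient (YoungTableau.rowSetoid lam)

/-- The tabloid of a tableau. -/
def YoungTableau.tabloid {n : ℕ} {lam : n.Partition} (t : YoungTableau lam) : Tabloid lam :=
  Quotient.mk (YoungTableau.rowSetoid lam) t

/-- The symmetric group acts on tabloids by `σ • {t} = {σ • t}`. -/
instance Tabloid.instMulAction {n : ℕ} {lam : n.Partition} :
    MulAction (Equiv.Perm (Fin n)) (Tabloid lam) where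
  smul σ := Quotient.map (σ • ·) fun _ _ h i => h (σ.symm i)
  one_smul T := by induction T using Quotient.inductionOn with | h t => rfl
  mul_smul σ τ T := by induction T using Quotient.inductionOn with | h t => rfl

open Classical in
/-- The polytabloid of `t`: the signed sum of the tabloids of `σ • t`, over the permutations `σ` in
the column stabilizer of `t`. -/
def YoungTableau.polytabloid {n : ℕ} {lam : n.Partition} (t : YoungTableau lam) :
    MonoidAlgebra ℂ (Tabloid lam) :=
  ∑ σ : Equiv.Perm (Fin n) with t.IsColumnPerm σ,
    MonoidAlgebra.single (σ • t).tabloid ((Equiv.Perm.sign σ : ℤ) : ℂ)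

theorem YoungTableau.isColumnPerm_smul_iff {n : ℕ} {lam : n.Partition} (t : YoungTableau lam)
    (g σ : Equiv.Perm (Fin n)) :
    (g • t).IsColumnPerm (g * σ * g⁻¹) ↔ t.IsColumnPerm σ := by
  have key : ∀ i, (g • t).col i = t.col (g⁻¹ i) := fun _ => rfl
  simp only [IsColumnPerm, key, Equiv.Perm.mul_apply]
  exact ⟨fun h i => by simpa using h (g i), fun h i => by simpa using h (g⁻¹ i)⟩

theorem YoungTableau.ofMulAction_polytabloid {n : ℕ} {lam : n.Partition} (t : YoungTableau lam)
    (g : Equiv.Perm (Fin n)) :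
    Representation.ofMulAction ℂ (Equiv.Perm (Fin n)) (Tabloid lam) g t.polytabloid =
      (g • t).polytabloid := by
  classical
  simp only [polytabloid, map_sum, Representation.ofMulAction_single]
  refine Finset.sum_equiv (MulAut.conj g).toEquiv (fun σ => ?_) (fun σ _ => ?_)
  · simpa using (t.isColumnPerm_smul_iff g σ).symm
  · have h1 : ((MulAut.conj g).toEquiv σ) = g * σ * g⁻¹ := rfl
    have h2 : (g * σ * g⁻¹) • g • t = g • σ • t := by simp [smul_smul]
    have h3 : Equiv.Perm.sign (g * σ * g⁻¹) = Equiv.Perm.sign σ := by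
      simp [mul_right_comm]
    rw [h1, h2, h3]
    rfl

/-- The Specht module of `lam`, as a subrepresentation of the permutation representation on
tabloids. -/
def specht {n : ℕ} (lam : n.Partition) :
    Subrepresentation
      (Representation.ofMulAction ℂ (Equiv.Perm (Fin n)) (Tabloid lam)) where
  toSubmodule := Submodule.span ℂ (Set.range YoungTableau.polytabloid)
  apply_mem_toSubmodule g v hv := by
    induction hv using Submodule.span_induction with
    | mem x hx =>
      obtain ⟨t, rfl⟩ := hx
      rw [t.ofMulAction_polytabloid]
      exact Submodule.subset_span ⟨_, rfl⟩
    | zero => simp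
    | add x y _ _ hx hy => rw [map_add]; exact Submodule.add_mem _ hx hy
    | smul a x _ hx => rw [map_smul]; exact Submodule.smul_mem _ a hx

/-- The irreducible complex character of the symmetric group indexed by `lam`. -/
def symChar {n : ℕ} (lam : n.Partition) (σ : Equiv.Perm (Fin n)) : ℂ :=
  (specht lam).toRepresentation.character σ

/-! ### Immanants and the Laplacian immanantal polynomial -/

/-- The immanant indexed by `lam ⊢ n` of an `n × n` matrix over a commutative `ℂ`-algebra. -/
def immanant {n : ℕ} (lam : n.Partition) {R : Type*} [CommRing R] [Algebra ℂ R]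
    (A : Matrix (Fin n) (Fin n) R) : R :=
  ∑ σ : Equiv.Perm (Fin n), algebraMap ℂ R (symChar lam σ) * ∏ i, A i (σ i)

/-- The Laplacian immanantal polynomial `imm_lam (x I - L_G)`. -/
def lapImmPoly {n : ℕ} (lam : n.Partition) (G : SimpleGraph (Fin n)) [DecidableRel G.Adj] : ℂ[X] :=
  immanant lam ((X : ℂ[X]) • (1 : Matrix (Fin n) (Fin n) ℂ[X]) - (G.lapMatrix ℂ).map C)

/-- For `r ≤ n`, the coefficient of `(-1)^r x^(n-r)` in the Laplacian immanantal polynomial. -/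
def lapImmCoeff {n : ℕ} (lam : n.Partition) (r : ℕ) (G : SimpleGraph (Fin n))
    [DecidableRel G.Adj] : ℂ :=
  (-1) ^ r * (lapImmPoly lam G).coeff (n - r)

/-! ### Generalized graph shift -/

namespace SimpleGraph

variable {V : Type*}

/-- The graph obtained from `G` by moving all neighbours of `v` except `w` to `u`: each edge `vx`
with `x ≠ w` is deleted and the edge `ux` is added in its place. -/
def moveNeighbors (G : SimpleGraph V) (u v w : V) : SimpleGraph V :=
  fromEdgeSet ((G.edgeSet \ {e | ∃ x ∈ G.neighborSet v \ {w}, e = s(v, x)}) ∪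
    {e | ∃ x ∈ G.neighborSet v \ {w}, e = s(u, x)})

/-- `H` is obtained from `G` by a generalized graph shift: there are distinct vertices `u` (the
recipient) and `v` (the donor) and a path from `u` to `v` all of whose interior vertices have
degree 2, no cycle of `G` contains both `u` and `v`, and `H` arises by moving all neighbours of `v`,
except the neighbour of `v` on the path, to `u`. -/
def IsGGS (G H : SimpleGraph V) : Prop :=
  ∃ (u v : V) (p : G.Walk u v), u ≠ v ∧ p.IsPath ∧
    (∀ x ∈ p.support, x ≠ u → x ≠ v → (G.neighborSet x).ncard = 2) ∧
    (∀ (a : V) (c : G.Walk a a), c.IsCycle → ¬ (u ∈ c.support ∧ v ∈ c.support)) ∧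
    H = G.moveNeighbors u v p.penultimate

end SimpleGraph

end

/-!
Expanding `∏ i, (x I - L_G) i (ψ i)` means choosing, at each vertex `i`, either `x` or an edge at
`i`, drawn as an arrow out of `i`; this is compatible with `ψ` exactly when `ψ` moves vertices along
arrows only. For bipartite `G` such a `ψ` has only even cycles, so no signs survive, and
`b_{λ,r}(L_G)` is the sum of `χ_λ ψ` over all arrow maps `F` with `r` arrows along `G` and all `ψ`
that follow `F`.

The followers of `F` are the products of disjoint arrow cycles. Dividing them all by a fixed
follower inverts some of these cycles and permutes the followers up to conjugacy, so
`∑ ψ, ∑ φ, χ_λ (ψ φ⁻¹)` is the number of followers times `∑ ψ, χ_λ ψ`; it is non-negative because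
characters are positive definite. The values of `χ_λ` are integers because polytabloids have
integer coefficients.

A generalized graph shift moves the branch `Y` at `v` across the path `P` to `u`. Redirecting the
arrows between `Y` and `u` to `v`, and turning the arrows on `P` around when `u` sends an arrow into
`Y`, injects the arrow maps along `H` into those along `G` and preserves the followers up to
conjugacy.
-/

noncomputable section

/-! ### Integrality of the characters -/

section Integrality

variable {R A N V : Type*} [CommRing R] [CommRing A] [Algebra R A] [AddCommGroup N] [Module R N]
  [AddCommGroup V] [Module A V] [Module R V] [IsScalarTower R A V]

theorem trace_eq_algebraMap_of_isBaseChange [Module.Free R N] [Module.Finite R N] {j : N →ₗ[R] V}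
    (hj : IsBaseChange A j) {φ : N →ₗ[R] N} {f : V →ₗ[A] V} (hf : ∀ x, f (j x) = j (φ x)) :
    LinearMap.trace A V f = algebraMap R A (LinearMap.trace R N φ) := by
  have hconj : f = hj.equiv.conj (φ.baseChange A) := hj.algHom_ext _ _ fun x => by
    rw [hf, LinearEquiv.conj_apply_apply, hj.equiv_symm_apply, LinearMap.baseChange_tmul,
      hj.equiv_tmul, one_smul]
  rw [hconj, LinearMap.trace_conj', LinearMap.trace_baseChange]

theorem exists_isBaseChange_of_span_eq [Module.Flat R A] {j : N →ₗ[R] V} (hj : IsBaseChange A j)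
    {p : Submodule R N} {W : Submodule A V} (hW : Submodule.span A (j '' p) = W) :
    ∃ i : p →ₗ[R] W, IsBaseChange A i ∧ ∀ x, (i x : V) = j x := by
  have hmap : (p.baseChange A).map hj.equiv.toLinearMap = W := by
    rw [← hW, Submodule.baseChange_eq_span, Submodule.map_span, Submodule.map_coe,
      Set.image_image]
    simp [hj.equiv_tmul]
  let i : p →ₗ[R] W := j.restrict (q := W.restrictScalars R)
    fun x hx => hW ▸ Submodule.subset_span ⟨x, hx, rfl⟩
  refine ⟨i, .of_equiv (Submodule.toBaseChange.toLinearEquiv A p ≪≫ₗ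
    hj.equiv.submoduleMap (p.baseChange A) ≪≫ₗ LinearEquiv.ofEq _ _ hmap) fun x => ?_, fun _ => rfl⟩
  apply Subtype.ext
  change hj.equiv (1 ⊗ₜ[R] (x : N)) = j x
  rw [hj.equiv_tmul, one_smul]

theorem exists_trace_restrict_eq_algebraMap [IsDomain R] [IsPrincipalIdealRing R]
    [Module.Flat R A] [Module.Free R N] [Module.Finite R N] {j : N →ₗ[R] V}
    (hj : IsBaseChange A j) {φ : N →ₗ[R] N} {f : V →ₗ[A] V} (hf : ∀ x, f (j x) = j (φ x))
    {s : Set N} {W : Submodule A V} (hs : Submodule.span A (j '' s) = W)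
    (hW : ∀ x ∈ W, f x ∈ W) :
    ∃ a : R, LinearMap.trace A W (f.restrict hW) = algebraMap R A a := by
  let p : Submodule R N := (W.restrictScalars R).comap j
  have hp : Submodule.span A (j '' p) = W := by
    refine le_antisymm (Submodule.span_le.2 ?_) ?_
    · rintro _ ⟨x, hx, rfl⟩
      exact hx
    · rw [← hs]
      exact Submodule.span_mono <| Set.image_mono fun x hx =>
        hs.le (Submodule.subset_span ⟨x, hx, rfl⟩)
  have hφ : ∀ x ∈ p, φ x ∈ p := fun x hx => by
    change j (φ x) ∈ W
    exact hf x ▸ hW _ hx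
  obtain ⟨i, hi, hij⟩ := exists_isBaseChange_of_span_eq hj hp
  exact ⟨_, trace_eq_algebraMap_of_isBaseChange hi (φ := φ.restrict hφ) fun x =>
    Subtype.ext <| by simp [hij, hf]⟩

end Integrality

section SymmetricGroupCharacter

variable {n : ℕ} (lam : n.Partition)

instance YoungTableau.instFinite : Finite (YoungTableau lam) :=
  Finite.of_injective YoungTableau.cell fun ⟨_⟩ ⟨_⟩ h => by cases h; rfl

instance Tabloid.instFinite : Finite (Tabloid lam) :=
  inferInstanceAs (Finite (Quotient _))

theorem exists_int_symChar (σ : Equiv.Perm (Fin n)) : ∃ z : ℤ, symChar lam σ = z := by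
  classical
  let e (t : YoungTableau lam) : Tabloid lam →₀ ℤ :=
    ∑ σ : Equiv.Perm (Fin n) with t.IsColumnPerm σ,
      Finsupp.single (σ • t).tabloid (Equiv.Perm.sign σ : ℤ)
  have hj := IsBaseChange.of_basis (A := ℤ) (MonoidAlgebra.basis (Tabloid lam) ℂ)
  refine exists_trace_restrict_eq_algebraMap hj (φ := Finsupp.lmapDomain ℤ ℤ (σ • ·))
    (f := Representation.ofMulAction ℂ _ (Tabloid lam) σ) (fun x => ?_) (s := Set.range e) ?_
    ((specht lam).apply_mem_toSubmodule σ)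
  · induction x using Finsupp.induction_linear with
    | zero => simp only [map_zero]
    | add x y hx hy => simp only [map_add, hx, hy]
    | single T a => simp
  · rw [← Set.range_comp]
    congr 2 with t
    simp [e, YoungTableau.polytabloid]

end SymmetricGroupCharacter

/-! ### Positive definiteness of characters -/

theorem character_eq_of_isConj {k G W : Type*} [Field k] [Group G] [AddCommGroup W] [Module k W]
    (ρ : Representation k G W) {g h : G} (hgh : IsConj g h) : ρ.character g = ρ.character h := by
  obtain ⟨c, rfl⟩ := isConj_iff.1 hgh
  exact (ρ.char_conj g c).symm

section PositiveDefiniteness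

open scoped ComplexOrder

variable {𝕜 Γ : Type*} [RCLike 𝕜] [Group Γ] [Finite Γ]

theorem posSemidef_character_of_inner {E : Type*} [NormedAddCommGroup E] [InnerProductSpace 𝕜 E]
    [FiniteDimensional 𝕜 E] {ρ : Representation 𝕜 Γ E}
    (hρ : ∀ g x y, inner 𝕜 (ρ g x) (ρ g y) = inner 𝕜 x y) :
    (Matrix.of fun g h => ρ.character (g * h⁻¹)).PosSemidef := by
  let b := stdOrthonormalBasis 𝕜 E
  have hgram : (Matrix.of fun g h => ρ.character (g * h⁻¹)) =
      ∑ i, Matrix.gram 𝕜 fun g => ρ g⁻¹ (b i) := by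
    ext g h
    rw [Matrix.of_apply, Representation.character, LinearMap.trace_eq_sum_inner _ b,
      Matrix.sum_apply]
    refine Finset.sum_congr rfl fun i _ => ?_
    rw [Matrix.gram_apply, ← hρ g (ρ g⁻¹ (b i)), Representation.self_inv_apply, map_mul,
      Module.End.mul_apply]
  rw [hgram]
  exact Matrix.posSemidef_sum _ fun i _ => Matrix.posSemidef_gram 𝕜 _

variable {V : Type*} [AddCommGroup V] [Module 𝕜 V] [FiniteDimensional 𝕜 V]

-- Weyl's unitary trick: average an arbitrary inner product over the group.
theorem exists_invariant_inner (ρ : Representation 𝕜 Γ V) :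
    ∃ c : InnerProductSpace.Core 𝕜 V, ∀ g x y, c.inner (ρ g x) (ρ g y) = c.inner x y := by
  have := Fintype.ofFinite Γ
  let e : V ≃ₗ[𝕜] EuclideanSpace 𝕜 (Fin (Module.finrank 𝕜 V)) :=
    LinearEquiv.ofFinrankEq _ _ (by simp)
  refine ⟨{
    inner x y := ∑ g, inner 𝕜 (e (ρ g x)) (e (ρ g y))
    conj_inner_symm x y := by simp only [map_sum, inner_conj_symm]
    re_inner_nonneg x := by
      rw [map_sum]
      exact Finset.sum_nonneg fun g _ => inner_self_nonneg
    add_left x y z := by simp only [map_add, inner_add_left, Finset.sum_add_distrib]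
    smul_left x y a := by simp only [map_smul, inner_smul_left, Finset.mul_sum]
    definite x hx := ?_ }, fun g x y => ?_⟩
  · have hsum : ∑ g, RCLike.re (inner 𝕜 (e (ρ g x)) (e (ρ g x))) = 0 := by
      rw [← map_sum, hx, map_zero]
    have hone := (Finset.sum_eq_zero_iff_of_nonneg fun g _ => inner_self_nonneg).1 hsum 1
      (Finset.mem_univ 1)
    simpa using hone
  · exact Fintype.sum_equiv (Equiv.mulRight g) _ _ fun h => by simp

theorem posSemidef_character (ρ : Representation 𝕜 Γ V) :
    (Matrix.of fun g h => ρ.character (g * h⁻¹)).PosSemidef := by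
  obtain ⟨c, hc⟩ := exists_invariant_inner ρ
  let _ : NormedAddCommGroup V := c.toNormedAddCommGroup
  let _ : InnerProductSpace 𝕜 V := .ofCore c.toCore
  exact posSemidef_character_of_inner hc

theorem sum_character_mul_inv_nonneg (ρ : Representation 𝕜 Γ V) (S : Finset Γ) :
    0 ≤ ∑ g ∈ S, ∑ h ∈ S, ρ.character (g * h⁻¹) := by
  simpa [Matrix.mulVec, dotProduct, ← Finset.sum_coe_sort S] using
    ((posSemidef_character ρ).submatrix ((↑) : S → Γ)).dotProduct_mulVec_nonneg 1

end PositiveDefiniteness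

/-! ### Arrow maps and their followers -/

section Permutation

variable {V : Type*}

theorem apply_mem_iff_of_mapsTo [Finite V] {ψ : Equiv.Perm V} {t : Set V} (h : Set.MapsTo ψ t t)
    {i : V} : ψ i ∈ t ↔ i ∈ t :=
  ⟨fun hi => by simpa using Equiv.Perm.perm_symm_mapsTo_of_mapsTo ψ h hi, fun hi => h hi⟩

theorem exists_perm_apply_eq_ite (ψ : Equiv.Perm V) {t : Set V} [DecidablePred (· ∈ t)]
    (ht : ∀ i, ψ i ∈ t ↔ i ∈ t) : ∃ κ : Equiv.Perm V, ∀ i, κ i = if i ∈ t then ψ i else i := by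
  refine ⟨Equiv.Perm.ofSubtype (ψ.subtypePerm ht), fun i => ?_⟩
  split_ifs with hi
  · exact Equiv.Perm.ofSubtype_apply_of_mem (p := (· ∈ t)) _ hi
  · exact Equiv.Perm.ofSubtype_apply_of_not_mem (p := (· ∈ t)) _ hi

theorem isConj_mul_inv_mul_of_disjoint [Finite V] {ψ φ : Equiv.Perm V} (h : ψ.Disjoint φ) :
    IsConj (ψ * φ⁻¹) (ψ * φ) := by
  classical
  have := Fintype.ofFinite V
  rw [Equiv.Perm.isConj_iff_cycleType_eq, h.inv_right.cycleType_mul, h.cycleType_mul,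
    Equiv.Perm.cycleType_inv]

end Permutation

/-- A choice of at most one arrow `i ⟶ j` out of each vertex `i`, recorded as `F i = some j`. -/
abbrev ArrowMap (V : Type*) := V → Option V

namespace ArrowMap

section Follower

variable {V : Type*} {F : ArrowMap V} {ψ φ : Equiv.Perm V}

/-- A permutation follows `F` if it moves vertices only along the arrows of `F`; its nontrivial
cycles are then cycles of arrows. -/
def IsFollower (F : ArrowMap V) (ψ : Equiv.Perm V) : Prop := ∀ i, ψ i = i ∨ F i = some (ψ i)

theorem isFollower_one : F.IsFollower 1 := fun _ => .inl rfl

theorem IsFollower.apply_eq_apply (hψ : F.IsFollower ψ) (hφ : F.IsFollower φ) {i : V}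
    (hi : ψ i ≠ i) (hi' : φ i ≠ i) : ψ i = φ i :=
  Option.some_injective _ (((hψ i).resolve_left hi).symm.trans ((hφ i).resolve_left hi'))

theorem IsFollower.of_apply_eq_ite (hψ : F.IsFollower ψ) {t : Set V} [DecidablePred (· ∈ t)]
    (h : ∀ i, φ i = if i ∈ t then ψ i else i) : F.IsFollower φ := fun i => by
  rw [h]
  split_ifs
  exacts [hψ i, .inl rfl]

theorem IsFollower.mul_of_disjoint (hψ : F.IsFollower ψ) (hφ : F.IsFollower φ)
    (h : ψ.Disjoint φ) : F.IsFollower (ψ * φ) := fun i => by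
  rcases h i with hi | hi
  · rw [h.commute.eq, Equiv.Perm.mul_apply, hi]
    exact hφ i
  · rw [Equiv.Perm.mul_apply, hi]
    exact hψ i

variable [Fintype V] [DecidableEq V]

theorem IsFollower.eq_of_support_eq (hψ : F.IsFollower ψ) (hφ : F.IsFollower φ)
    (h : ψ.support = φ.support) : ψ = φ := by
  ext1 i
  have hi : ψ i ≠ i ↔ φ i ≠ i := by rw [← Equiv.Perm.mem_support, h, Equiv.Perm.mem_support]
  by_cases hψi : ψ i = i
  · rw [hψi, not_not.1 (mt hi.2 (not_not.2 hψi))]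
  · exact hψ.apply_eq_apply hφ hψi (hi.1 hψi)

-- The cycles shared by `ψ` and `φ` cancel in `ψ * φ⁻¹`; inverting the remaining cycles of `φ` does
-- not change the cycle type.
theorem IsFollower.exists_isConj_mul_inv (hψ : F.IsFollower ψ) (hφ : F.IsFollower φ) :
    ∃ s, F.IsFollower s ∧ IsConj (ψ * φ⁻¹) s ∧ s.support = symmDiff ψ.support φ.support := by
  let t : Set V := {i | ψ i ≠ i ∧ φ i ≠ i}
  have agree : Set.EqOn ψ φ t := fun i hi => hψ.apply_eq_apply hφ hi.1 hi.2
  have hψt : Set.MapsTo ψ t t := fun i hi =>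
    ⟨ψ.injective.ne hi.1, agree hi ▸ φ.injective.ne hi.2⟩
  have hφt : Set.MapsTo φ t t := hψt.congr agree
  obtain ⟨κ, hκ⟩ := exists_perm_apply_eq_ite ψ fun i => apply_mem_iff_of_mapsTo hψt
  obtain ⟨a, ha⟩ := exists_perm_apply_eq_ite ψ (t := tᶜ) fun i => (apply_mem_iff_of_mapsTo hψt).not
  obtain ⟨b, hb⟩ := exists_perm_apply_eq_ite φ (t := tᶜ) fun i => (apply_mem_iff_of_mapsTo hφt).not
  have hψa : ψ = a * κ := by
    ext1 i
    by_cases hi : i ∈ t <;> simp [ha, hκ, hi, apply_mem_iff_of_mapsTo hψt]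
  have hφb : φ = b * κ := by
    ext1 i
    by_cases hi : i ∈ t
    · simp [hb, hκ, hi, agree hi, apply_mem_iff_of_mapsTo hφt]
    · simp [hb, hκ, hi]
  have hab : a.Disjoint b := fun i => by
    simp only [ha, hb, t, Set.mem_compl_iff, Set.mem_ofPred_eq]
    split_ifs <;> tauto
  refine ⟨a * b, (hψ.of_apply_eq_ite ha).mul_of_disjoint (hφ.of_apply_eq_ite hb) hab, ?_, ?_⟩
  · rw [hψa, hφb]
    simpa [mul_assoc] using isConj_mul_inv_mul_of_disjoint hab
  · ext i
    simp only [hab.support_mul, Finset.mem_union, Finset.mem_symmDiff, Equiv.Perm.mem_support,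
      ha, hb, t, Set.mem_compl_iff, Set.mem_ofPred_eq]
    split_ifs <;> tauto

end Follower

section FollowerSum

variable {V : Type*} [Fintype V] [DecidableEq V] (F : ArrowMap V)

instance : DecidablePred F.IsFollower :=
  fun ψ => inferInstanceAs (Decidable (∀ i, ψ i = i ∨ F i = some (ψ i)))

/-- The finite set of permutations following `F`. -/
def followers : Finset (Equiv.Perm V) := {ψ | F.IsFollower ψ}

variable {F}

theorem mem_followers {ψ : Equiv.Perm V} : ψ ∈ F.followers ↔ F.IsFollower ψ := by
  simp [followers]

theorem sum_followers_mul_inv {M : Type*} [AddCommMonoid M] {χ : Equiv.Perm V → M}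
    (hχ : ∀ σ τ, IsConj σ τ → χ σ = χ τ) {φ : Equiv.Perm V} (hφ : F.IsFollower φ) :
    ∑ ψ ∈ F.followers, χ (ψ * φ⁻¹) = ∑ ψ ∈ F.followers, χ ψ := by
  choose! s hs hconj hsupp using fun ψ (hψ : ψ ∈ F.followers) =>
    (mem_followers.1 hψ).exists_isConj_mul_inv hφ
  have hmaps : Set.MapsTo s F.followers F.followers := fun ψ hψ => mem_followers.2 (hs ψ hψ)
  have hinj : Set.InjOn s F.followers := fun ψ hψ ψ' hψ' h =>
    (mem_followers.1 hψ).eq_of_support_eq (mem_followers.1 hψ') <|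
      symmDiff_left_injective φ.support <|
        (hsupp ψ hψ).symm.trans <| (congrArg _ h).trans <| hsupp ψ' hψ'
  exact Finset.sum_nbij s hmaps hinj (Finset.surjOn_of_injOn_of_card_le s hmaps hinj le_rfl)
    fun ψ hψ => hχ _ _ (hconj ψ hψ)

open scoped ComplexOrder in
theorem sum_character_followers_nonneg {𝕜 W : Type*} [RCLike 𝕜] [AddCommGroup W] [Module 𝕜 W]
    [FiniteDimensional 𝕜 W] (ρ : Representation 𝕜 (Equiv.Perm V) W) (F : ArrowMap V) :
    0 ≤ ∑ ψ ∈ F.followers, ρ.character ψ := by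
  have hdouble : ∑ φ ∈ F.followers, ∑ ψ ∈ F.followers, ρ.character (ψ * φ⁻¹) =
      F.followers.card * ∑ ψ ∈ F.followers, ρ.character ψ := by
    have hinner {φ} (hφ : φ ∈ F.followers) : ∑ ψ ∈ F.followers, ρ.character (ψ * φ⁻¹) =
        ∑ ψ ∈ F.followers, ρ.character ψ :=
      sum_followers_mul_inv (fun _ _ h => character_eq_of_isConj ρ h) (mem_followers.1 hφ)
    rw [Finset.sum_congr rfl fun φ hφ => hinner hφ, Finset.sum_const, nsmul_eq_mul]
  have hcard : (0 : 𝕜) < F.followers.card := by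
    exact_mod_cast Finset.card_pos.2 ⟨1, mem_followers.2 isFollower_one⟩
  refine le_of_mul_le_mul_left ?_ hcard
  rw [mul_zero, ← hdouble, Finset.sum_comm]
  exact sum_character_mul_inv_nonneg ρ _

end FollowerSum

end ArrowMap

/-! ### Expansion of the Laplacian immanantal polynomial -/

section Laplacian

open Matrix

variable {V : Type*} {G : SimpleGraph V}

namespace ArrowMap

/-- All arrows of `F` run along edges of `G`. -/
def IsAlong (F : ArrowMap V) (G : SimpleGraph V) : Prop := ∀ i j, F i = some j → G.Adj i j

theorem IsFollower.eq_or_adj {F : ArrowMap V} {σ : Equiv.Perm V} (hσ : F.IsFollower σ)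
    (hF : F.IsAlong G) (i : V) : σ i = i ∨ G.Adj i (σ i) :=
  (hσ i).imp_right (hF i _)

/-- The number of vertices that `F` sends an arrow out of. -/
def numArrows [Fintype V] (F : ArrowMap V) : ℕ := Finset.card {i | F i ≠ none}

end ArrowMap

variable [Fintype V]

open Classical in
/-- The arrow maps with exactly `r` arrows, all along edges of `G`. -/
def arrowMaps (G : SimpleGraph V) (r : ℕ) : Finset (ArrowMap V) :=
  {F | F.IsAlong G ∧ F.numArrows = r}

theorem mem_arrowMaps {r : ℕ} {F : ArrowMap V} :
    F ∈ arrowMaps G r ↔ F.IsAlong G ∧ F.numArrows = r := by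
  simp [arrowMaps]

variable (R : Type*) [CommRing R]

theorem prod_option_elim_X (F : ArrowMap V) :
    ∏ i, (F i).elim (X : R[X]) (fun _ => -1) =
      (-1) ^ F.numArrows * X ^ (Fintype.card V - F.numArrows) := by
  have helim (i : V) : (F i).elim (X : R[X]) (fun _ => -1) = if F i = none then X else -1 := by
    cases F i <;> rfl
  have hcard : Finset.card {i | F i = none} + F.numArrows = Fintype.card V :=
    Finset.card_filter_add_card_filter_not _
  rw [Finset.prod_congr rfl fun i _ => helim i, Finset.prod_ite, Finset.prod_const,
    Finset.prod_const, mul_comm, ← hcard, Nat.add_sub_cancel]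
  rfl

variable [DecidableEq V]

theorem even_card_support_of_isBipartite (hG : G.IsBipartite) {σ : Equiv.Perm V}
    (hσ : ∀ i, σ i = i ∨ G.Adj i (σ i)) : Even σ.support.card := by
  obtain ⟨c⟩ := hG
  have hc {i} (hi : σ i ≠ i) : c i = 0 ↔ ¬ c (σ i) = 0 := by
    have := c.valid ((hσ i).resolve_left hi)
    omega
  have hcard : (σ.support.filter (c · = 0)).card = (σ.support.filter (¬ c · = 0)).card :=
    Finset.card_equiv σ fun i => by
      simp only [Finset.mem_filter, Equiv.Perm.apply_mem_support, and_congr_right_iff]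
      exact fun hi => hc (Equiv.Perm.mem_support.1 hi)
  rw [← Finset.card_filter_add_card_filter_not (s := σ.support) (c · = 0), hcard]
  exact Even.add_self _

variable [DecidableRel G.Adj]

open Classical in
-- For `k = i` the summand `none` gives `X` and the arrows out of `i` give minus the degree.
theorem charmatrix_lapMatrix_apply (i k : V) :
    charmatrix (G.lapMatrix R) i k = (if k = i then 1 else -1) *
      ∑ o : Option V with (∀ j, o = some j → G.Adj i j) ∧ (k = i ∨ o = some k),
        o.elim X fun _ => -1 := by
  rw [Finset.sum_filter, Fintype.sum_option]
  rcases eq_or_ne k i with rfl | h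
  · simp [SimpleGraph.lapMatrix, SimpleGraph.degMatrix, sub_eq_add_neg, Finset.sum_ite,
      ← SimpleGraph.card_neighborFinset_eq_degree, SimpleGraph.neighborFinset_eq_filter]
  · rw [Finset.sum_eq_single k (fun j _ hj => by simp [h, hj]) (by simp)]
    simp [SimpleGraph.lapMatrix, SimpleGraph.degMatrix, h, h.symm]

open Classical in
theorem prod_charmatrix_lapMatrix (hG : G.IsBipartite) (σ : Equiv.Perm V) :
    ∏ i, charmatrix (G.lapMatrix R) i (σ i) =
      ∑ F : ArrowMap V with F.IsAlong G ∧ F.IsFollower σ,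
        (-1) ^ F.numArrows * X ^ (Fintype.card V - F.numArrows) := by
  have hsign : ∏ i, (if σ i = i then 1 else -1 : R[X]) = (-1) ^ σ.support.card := by
    rw [Finset.prod_ite, Finset.prod_const_one, one_mul, Finset.prod_const]
    rfl
  simp only [charmatrix_lapMatrix_apply, Finset.prod_mul_distrib, hsign]
  rw [Finset.prod_univ_sum, Finset.mul_sum]
  refine Finset.sum_congr (Finset.ext fun F => ?_) fun F hF => ?_
  · simp only [Fintype.mem_piFinset, Finset.mem_filter_univ, forall_and]
    rfl
  · obtain ⟨hFG, hσ⟩ := (Finset.mem_filter.1 hF).2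
    rw [prod_option_elim_X, (even_card_support_of_isBipartite hG (hσ.eq_or_adj hFG)).neg_one_pow,
      one_mul]

open Classical in
theorem coeff_prod_charmatrix_lapMatrix (hG : G.IsBipartite) (σ : Equiv.Perm V) {r : ℕ}
    (hr : r ≤ Fintype.card V) :
    (∏ i, charmatrix (G.lapMatrix R) i (σ i)).coeff (Fintype.card V - r) =
      ∑ F ∈ arrowMaps G r with F.IsFollower σ, (-1) ^ r := by
  have hcoeff (F : ArrowMap V) : ((-1) ^ F.numArrows * X ^ (Fintype.card V - F.numArrows) :
      R[X]).coeff (Fintype.card V - r) = if F.numArrows = r then (-1) ^ r else 0 := by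
    have hF : F.numArrows ≤ Fintype.card V := Finset.card_le_univ _
    rw [show ((-1) ^ F.numArrows : R[X]) = C ((-1) ^ F.numArrows) by simp, coeff_C_mul_X_pow]
    by_cases h : F.numArrows = r
    · simp [h]
    · rw [if_neg (by omega), if_neg h]
  rw [prod_charmatrix_lapMatrix R hG, finsetSum_coeff]
  simp only [hcoeff, ← Finset.sum_filter, arrowMaps, Finset.filter_filter]
  exact Finset.sum_congr (Finset.ext fun F => by simp only [Finset.mem_filter_univ, and_right_comm])
    fun _ _ => rfl

theorem sum_mul_coeff_prod_charmatrix_lapMatrix (hG : G.IsBipartite) (χ : Equiv.Perm V → R)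
    {r : ℕ} (hr : r ≤ Fintype.card V) :
    ∑ σ, χ σ * (∏ i, charmatrix (G.lapMatrix R) i (σ i)).coeff (Fintype.card V - r) =
      (-1) ^ r * ∑ F ∈ arrowMaps G r, ∑ ψ ∈ F.followers, χ ψ := by
  classical
  simp only [coeff_prod_charmatrix_lapMatrix R hG _ hr, Finset.mul_sum, ArrowMap.followers,
    Finset.sum_filter]
  rw [Finset.sum_comm]
  simp [mul_comm]

end Laplacian

/-! ### Shifting a branch -/

section Relabelling

namespace ArrowMap

variable {V : Type*} {F : ArrowMap V} {A : Set V} {ρ τ : Equiv.Perm V}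

open Classical in
/-- The arrow map whose arrows out of `A` are the images under `ρ` of the arrows of `F`. Arrows into
`A` from outside are left alone. -/
def relabelOn (F : ArrowMap V) (A : Set V) (ρ : Equiv.Perm V) : ArrowMap V :=
  fun i => if i ∈ A then (F (ρ i)).map ρ else F i

theorem relabelOn_of_mem {i : V} (hi : i ∈ A) : F.relabelOn A ρ i = (F (ρ i)).map ρ := if_pos hi

theorem relabelOn_of_notMem {i : V} (hi : i ∉ A) : F.relabelOn A ρ i = F i := if_neg hi

/-- No arrow of `F` leaves `A`. -/
def IsClosedOn (F : ArrowMap V) (A : Set V) : Prop := ∀ i ∈ A, ∀ j, F i = some j → j ∈ A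

theorem IsFollower.mapsTo (hF : F.IsClosedOn A) {ψ : Equiv.Perm V} (hψ : F.IsFollower ψ) :
    Set.MapsTo ψ A A := fun i hi =>
  (hψ i).elim (fun h => h.symm ▸ hi) (hF i hi _)

theorem IsFollower.apply_mem_iff [Finite V] (hF : F.IsClosedOn A ∨ F.IsClosedOn Aᶜ)
    {ψ : Equiv.Perm V} (hψ : F.IsFollower ψ) (i : V) : ψ i ∈ A ↔ i ∈ A :=
  hF.elim (fun h => apply_mem_iff_of_mapsTo (hψ.mapsTo h))
    fun h => not_iff_not.1 (apply_mem_iff_of_mapsTo (hψ.mapsTo h))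

theorem relabelOn_relabelOn (hρ : Function.Involutive ρ) (hA : ∀ i, ρ i ∈ A ↔ i ∈ A) :
    (F.relabelOn A ρ).relabelOn A ρ = F := by
  funext i
  by_cases hi : i ∈ A
  · rw [relabelOn_of_mem hi, relabelOn_of_mem ((hA i).2 hi), hρ i, Option.map_map,
      hρ.comp_self, Option.map_id, id]
  · rw [relabelOn_of_notMem hi, relabelOn_of_notMem hi]

theorem isClosedOn_relabelOn (hA : ∀ i, ρ i ∈ A ↔ i ∈ A)
    (hF : F.IsClosedOn A ∨ F.IsClosedOn Aᶜ) :
    (F.relabelOn A ρ).IsClosedOn A ∨ (F.relabelOn A ρ).IsClosedOn Aᶜ := by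
  refine hF.imp (fun h i hi j hij => ?_) fun h i hi j hij => ?_
  · rw [relabelOn_of_mem hi, Option.map_eq_some_iff] at hij
    obtain ⟨k, hk, rfl⟩ := hij
    exact (hA k).2 (h _ ((hA i).2 hi) k hk)
  · rw [relabelOn_of_notMem hi] at hij
    exact h i hi j hij

section Conj

variable [DecidablePred (· ∈ A)] (hτ : ∀ i, τ i = if i ∈ A then ρ i else i)
include hτ

theorem IsFollower.conj_relabelOn [Finite V] (hρ : Function.Involutive ρ)
    (hA : ∀ i, ρ i ∈ A ↔ i ∈ A) (hF : F.IsClosedOn A ∨ F.IsClosedOn Aᶜ) {ψ : Equiv.Perm V}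
    (hψ : F.IsFollower ψ) : (F.relabelOn A ρ).IsFollower (τ * ψ * τ) := fun i => by
  simp only [Equiv.Perm.mul_apply]
  by_cases hi : i ∈ A
  · have hmem : ψ (ρ i) ∈ A := (hψ.apply_mem_iff hF _).2 ((hA i).2 hi)
    rw [hτ i, if_pos hi, hτ, if_pos hmem, relabelOn_of_mem hi]
    exact (hψ (ρ i)).imp (fun h => by rw [h, hρ]) fun h => by rw [h, Option.map_some]
  · have hmem : ψ i ∉ A := (hψ.apply_mem_iff hF _).not.2 hi
    rw [hτ i, if_neg hi, hτ, if_neg hmem, relabelOn_of_notMem hi]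
    exact hψ i

theorem involutive_of_apply_eq_ite (hρ : Function.Involutive ρ) (hA : ∀ i, ρ i ∈ A ↔ i ∈ A) :
    Function.Involutive τ := fun i => by
  by_cases hi : i ∈ A <;> simp [hτ, hi, hA, hρ i]

end Conj

variable [Fintype V]

theorem numArrows_relabelOn (hA : ∀ i, ρ i ∈ A ↔ i ∈ A) :
    (F.relabelOn A ρ).numArrows = F.numArrows := by
  classical
  obtain ⟨τ, hτ⟩ := exists_perm_apply_eq_ite ρ hA
  refine Finset.card_equiv τ fun i => ?_
  by_cases hi : i ∈ A <;>
    simp [relabelOn_of_mem, relabelOn_of_notMem, hτ, hi]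

theorem sum_followers_relabelOn [DecidableEq V] {M : Type*} [AddCommMonoid M]
    {χ : Equiv.Perm V → M} (hχ : ∀ σ σ', IsConj σ σ' → χ σ = χ σ') (hρ : Function.Involutive ρ)
    (hA : ∀ i, ρ i ∈ A ↔ i ∈ A) (hF : F.IsClosedOn A ∨ F.IsClosedOn Aᶜ) :
    ∑ ψ ∈ (F.relabelOn A ρ).followers, χ ψ = ∑ ψ ∈ F.followers, χ ψ := by
  classical
  obtain ⟨τ, hτ⟩ := exists_perm_apply_eq_ite ρ hA
  have hinv : τ * τ = 1 := Equiv.ext (involutive_of_apply_eq_ite hτ hρ hA)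
  have hconj (ψ) : τ * (τ * ψ * τ) * τ = ψ := by
    rw [← mul_assoc, ← mul_assoc, hinv, one_mul, mul_assoc, hinv, mul_one]
  symm
  refine Finset.sum_nbij' (fun ψ => τ * ψ * τ) (fun ψ => τ * ψ * τ) (fun ψ hψ => ?_)
    (fun ψ hψ => ?_) (fun ψ _ => hconj ψ) (fun ψ _ => hconj ψ) fun ψ _ => ?_
  · exact mem_followers.2 <| (mem_followers.1 hψ).conj_relabelOn hτ hρ hA hF
  · have := (mem_followers.1 hψ).conj_relabelOn hτ hρ hA (isClosedOn_relabelOn hA hF)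
    rw [relabelOn_relabelOn hρ hA] at this
    exact mem_followers.2 this
  · refine hχ _ _ <| isConj_iff.2 ⟨τ, ?_⟩
    rw [inv_eq_of_mul_eq_one_right hinv]

end ArrowMap

end Relabelling

section BranchShift

variable {V : Type*}

/-- `G` contains a part `P` joining `u` to `v` and a part `Y` hanging at `v`, and `ρ` is a
reversal of `P` exchanging `u` and `v`; `H` is obtained from `G` by moving `Y` from `v` to `u`. -/
structure IsBranchShift (G H : SimpleGraph V) (u v : V) (P Y : Set V) (ρ : Equiv.Perm V) :
    Prop where
  ne : u ≠ v
  left_mem : u ∈ P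
  disjoint : Disjoint P Y
  involutive : Function.Involutive ρ
  map_left : ρ u = v
  map_mem : ∀ i ∈ P, ρ i ∈ P
  map_eq : ∀ i ∉ P, ρ i = i
  adj_map : ∀ i ∈ P, ∀ j ∈ P, G.Adj i j → G.Adj (ρ i) (ρ j)
  adj_leave : ∀ i ∈ P, ∀ j ∉ P, G.Adj i j → (i = u ∧ j ∉ Y) ∨ (i = v ∧ j ∈ Y)
  adj_of_mem_iff : ∀ i j, (i ∈ Y ↔ j ∈ Y) → H.Adj i j → G.Adj i j
  adj_cross : ∀ i ∈ Y, ∀ j ∉ Y, H.Adj i j → j = u ∧ G.Adj i v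

open Classical in
/-- Turns arrow maps along the shifted graph into arrow maps along the original one: the arrows from
`Y` to `u` are redirected to `v` and, if `F` also has an arrow from `u` into `Y`, all arrows out of
`P` are reversed along with them. -/
def ArrowMap.transfer (F : ArrowMap V) (u : V) (P Y : Set V) (ρ : Equiv.Perm V) : ArrowMap V :=
  if ∃ y ∈ Y, F u = some y then F.relabelOn (P ∪ Y) ρ else F.relabelOn Y ρ

namespace IsBranchShift

variable {G H : SimpleGraph V} {u v : V} {P Y : Set V} {ρ : Equiv.Perm V} {F : ArrowMap V}
  (hs : IsBranchShift G H u v P Y ρ)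
include hs

theorem isBipartite (hG : G.IsBipartite) : H.IsBipartite := by
  classical
  obtain ⟨c⟩ := hG
  have hcross {i j} (hi : i ∈ Y) (hj : j ∉ Y) (hij : H.Adj i j) : c i + c v + c u ≠ c j := by
    obtain ⟨rfl, hiv⟩ := hs.adj_cross i hi j hj hij
    have := c.valid hiv
    omega
  refine ⟨.mk (fun i => if i ∈ Y then c i + c v + c u else c i) fun {i j} hij => ?_⟩
  by_cases hi : i ∈ Y <;> by_cases hj : j ∈ Y
  · simpa [hi, hj] using c.valid (hs.adj_of_mem_iff i j (iff_of_true hi hj) hij)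
  · simpa only [if_pos hi, if_neg hj] using hcross hi hj hij
  · simpa only [if_pos hj, if_neg hi] using (hcross hj hi hij.symm).symm
  · simpa [hi, hj] using c.valid (hs.adj_of_mem_iff i j (iff_of_false hi hj) hij)

theorem notMem_of_mem {i : V} (hi : i ∈ P) : i ∉ Y := hs.disjoint.notMem_of_mem_left hi

theorem map_right : ρ v = u := by rw [← hs.map_left, hs.involutive]

theorem right_mem : v ∈ P := hs.map_left ▸ hs.map_mem u hs.left_mem

theorem map_mem_iff_left (i : V) : ρ i ∈ P ↔ i ∈ P :=
  ⟨fun h => hs.involutive i ▸ hs.map_mem _ h, hs.map_mem i⟩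

theorem map_mem_iff_branch (i : V) : ρ i ∈ Y ↔ i ∈ Y := by
  by_cases hi : i ∈ P
  · exact iff_of_false (hs.notMem_of_mem (hs.map_mem i hi)) (hs.notMem_of_mem hi)
  · rw [hs.map_eq i hi]

theorem map_mem_union_iff (i : V) : ρ i ∈ P ∪ Y ↔ i ∈ P ∪ Y :=
  or_congr (hs.map_mem_iff_left i) (hs.map_mem_iff_branch i)

theorem map_eq_of_mem_branch {i : V} (hi : i ∈ Y) : ρ i = i :=
  hs.map_eq i fun h => hs.notMem_of_mem h hi

theorem eq_left_of_adj {i j : V} (hi : i ∉ Y) (hj : j ∈ Y) (h : H.Adj i j) : i = u :=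
  (hs.adj_cross j hj i hi h.symm).1

theorem mem_of_adj {i j : V} (hi : i ∈ P) (hiu : i ≠ u) (h : H.Adj i j) : j ∈ P := by
  by_contra hj
  have hiY := hs.notMem_of_mem hi
  have hjY : j ∉ Y := fun hjY => hiu (hs.eq_left_of_adj hiY hjY h)
  rcases hs.adj_leave i hi j hj (hs.adj_of_mem_iff i j (iff_of_false hiY hjY) h) with h | h
  exacts [hiu h.1, hjY h.2]

theorem isClosedOn_union (hF : F.IsAlong H) (hu : ∃ y ∈ Y, F u = some y) :
    F.IsClosedOn (P ∪ Y) := by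
  obtain ⟨y, hy, huy⟩ := hu
  rintro i (hi | hi) j hij
  · by_cases hiu : i = u
    · rw [hiu, huy, Option.some_inj] at hij
      exact .inr (hij ▸ hy)
    · exact .inl (hs.mem_of_adj hi hiu (hF i j hij))
  · by_cases hj : j ∈ Y
    · exact .inr hj
    · exact .inl ((hs.adj_cross i hi j hj (hF i j hij)).1 ▸ hs.left_mem)

theorem isClosedOn_compl (hF : F.IsAlong H) (hu : ¬ ∃ y ∈ Y, F u = some y) :
    F.IsClosedOn Yᶜ := fun i hi j hij hj =>
  hu ⟨j, hj, hs.eq_left_of_adj hi hj (hF i j hij) ▸ hij⟩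

theorem adj_map_of_mem_branch {i j : V} (hi : i ∈ Y) (h : H.Adj i j) : G.Adj i (ρ j) := by
  by_cases hj : j ∈ Y
  · rw [hs.map_eq_of_mem_branch hj]
    exact hs.adj_of_mem_iff i j (iff_of_true hi hj) h
  · obtain ⟨rfl, hiv⟩ := hs.adj_cross i hi j hj h
    rwa [hs.map_left]

theorem isAlong_relabelOn_union (hF : F.IsAlong H) (hu : ∃ y ∈ Y, F u = some y) :
    (F.relabelOn (P ∪ Y) ρ).IsAlong G := by
  obtain ⟨y, hy, huy⟩ := hu
  intro i j hij
  by_cases hi : i ∈ P ∪ Y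
  · rw [ArrowMap.relabelOn_of_mem hi, Option.map_eq_some_iff] at hij
    obtain ⟨k, hik, rfl⟩ := hij
    rcases hi with hi | hi
    · by_cases hiu : ρ i = u
      · obtain rfl : i = v := by rw [← hs.map_left, ← hiu, hs.involutive]
        rw [hiu, huy, Option.some_inj] at hik
        subst hik
        rw [hs.map_eq_of_mem_branch hy]
        exact (hs.adj_cross y hy u (hs.notMem_of_mem hs.left_mem) (hF u y huy).symm).2.symm
      · have hmem := hs.map_mem i hi
        have hk := hs.mem_of_adj hmem hiu (hF _ _ hik)
        have hadj := hs.adj_of_mem_iff _ _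
          (iff_of_false (hs.notMem_of_mem hmem) (hs.notMem_of_mem hk)) (hF _ _ hik)
        simpa only [hs.involutive i] using hs.adj_map _ hmem _ hk hadj
    · rw [hs.map_eq_of_mem_branch hi] at hik
      exact hs.adj_map_of_mem_branch hi (hF _ _ hik)
  · obtain ⟨hiP, hiY⟩ := not_or.1 hi
    rw [ArrowMap.relabelOn_of_notMem hi] at hij
    have hj : j ∉ Y := fun hj => hiP (hs.eq_left_of_adj hiY hj (hF i j hij) ▸ hs.left_mem)
    exact hs.adj_of_mem_iff i j (iff_of_false hiY hj) (hF i j hij)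

theorem isAlong_relabelOn_branch (hF : F.IsAlong H) (hu : ¬ ∃ y ∈ Y, F u = some y) :
    (F.relabelOn Y ρ).IsAlong G := by
  intro i j hij
  by_cases hi : i ∈ Y
  · rw [ArrowMap.relabelOn_of_mem hi, hs.map_eq_of_mem_branch hi, Option.map_eq_some_iff] at hij
    obtain ⟨k, hik, rfl⟩ := hij
    exact hs.adj_map_of_mem_branch hi (hF i k hik)
  · rw [ArrowMap.relabelOn_of_notMem hi] at hij
    have hj : j ∉ Y := hs.isClosedOn_compl hF hu i hi j hij
    exact hs.adj_of_mem_iff i j (iff_of_false hi hj) (hF i j hij)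

theorem isAlong_transfer (hF : F.IsAlong H) : (F.transfer u P Y ρ).IsAlong G := by
  unfold ArrowMap.transfer
  split_ifs with hu
  exacts [hs.isAlong_relabelOn_union hF hu, hs.isAlong_relabelOn_branch hF hu]

theorem numArrows_transfer [Fintype V] : (F.transfer u P Y ρ).numArrows = F.numArrows := by
  unfold ArrowMap.transfer
  split_ifs
  exacts [ArrowMap.numArrows_relabelOn hs.map_mem_union_iff,
    ArrowMap.numArrows_relabelOn hs.map_mem_iff_branch]

theorem sum_followers_transfer [Fintype V] [DecidableEq V] {M : Type*} [AddCommMonoid M]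
    {χ : Equiv.Perm V → M} (hχ : ∀ σ τ, IsConj σ τ → χ σ = χ τ) (hF : F.IsAlong H) :
    ∑ ψ ∈ (F.transfer u P Y ρ).followers, χ ψ = ∑ ψ ∈ F.followers, χ ψ := by
  unfold ArrowMap.transfer
  split_ifs with hu
  · exact ArrowMap.sum_followers_relabelOn hχ hs.involutive hs.map_mem_union_iff
      (.inl (hs.isClosedOn_union hF hu))
  · exact ArrowMap.sum_followers_relabelOn hχ hs.involutive hs.map_mem_iff_branch
      (.inr (hs.isClosedOn_compl hF hu))

-- An arrow of the transferred map from `v` into `Y` reveals which case of the definition applied.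
theorem exists_transfer_right_iff (hF : F.IsAlong H) :
    (∃ y ∈ Y, F.transfer u P Y ρ v = some y) ↔ ∃ y ∈ Y, F u = some y := by
  unfold ArrowMap.transfer
  split_ifs with hu
  · refine iff_of_true ?_ hu
    obtain ⟨y, hy, huy⟩ := hu
    refine ⟨y, hy, ?_⟩
    rw [ArrowMap.relabelOn_of_mem (.inl hs.right_mem), hs.map_right, huy, Option.map_some,
      hs.map_eq_of_mem_branch hy]
  · refine iff_of_false ?_ hu
    have hv := hs.notMem_of_mem hs.right_mem
    rw [ArrowMap.relabelOn_of_notMem hv]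
    exact fun ⟨y, hy, hvy⟩ => hs.ne (hs.eq_left_of_adj hv hy (hF v y hvy)).symm

theorem injOn_transfer : Set.InjOn (ArrowMap.transfer · u P Y ρ) {F | F.IsAlong H} := by
  intro F hF F' hF' h
  have hcase : (∃ y ∈ Y, F u = some y) ↔ ∃ y ∈ Y, F' u = some y := by
    rw [← hs.exists_transfer_right_iff hF, ← hs.exists_transfer_right_iff hF']
    simp only at h
    rw [h]
  by_cases hu : ∃ y ∈ Y, F u = some y
  · simp only [ArrowMap.transfer, if_pos hu, if_pos (hcase.1 hu)] at h
    simpa only [ArrowMap.relabelOn_relabelOn hs.involutive hs.map_mem_union_iff]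
      using congrArg (ArrowMap.relabelOn · (P ∪ Y) ρ) h
  · simp only [ArrowMap.transfer, if_neg hu, if_neg (hcase.not.1 hu)] at h
    simpa only [ArrowMap.relabelOn_relabelOn hs.involutive hs.map_mem_iff_branch]
      using congrArg (ArrowMap.relabelOn · Y ρ) h

theorem sum_arrowMaps_le [Fintype V] [DecidableEq V] {M : Type*} [AddCommMonoid M] [PartialOrder M]
    [IsOrderedAddMonoid M] {χ : Equiv.Perm V → M} (hχ : ∀ σ τ, IsConj σ τ → χ σ = χ τ)
    (hnonneg : ∀ F : ArrowMap V, 0 ≤ ∑ ψ ∈ F.followers, χ ψ) (r : ℕ) :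
    ∑ F ∈ arrowMaps H r, ∑ ψ ∈ F.followers, χ ψ ≤
      ∑ F ∈ arrowMaps G r, ∑ ψ ∈ F.followers, χ ψ := by
  classical
  have hinj : Set.InjOn (ArrowMap.transfer · u P Y ρ) (arrowMaps H r) :=
    hs.injOn_transfer.mono fun F hF => (mem_arrowMaps.1 hF).1
  calc ∑ F ∈ arrowMaps H r, ∑ ψ ∈ F.followers, χ ψ
      = ∑ F ∈ arrowMaps H r, ∑ ψ ∈ (F.transfer u P Y ρ).followers, χ ψ :=
        Finset.sum_congr rfl fun F hF =>
          (hs.sum_followers_transfer hχ (mem_arrowMaps.1 hF).1).symm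
    _ = ∑ F ∈ (arrowMaps H r).image (ArrowMap.transfer · u P Y ρ), ∑ ψ ∈ F.followers, χ ψ :=
        (Finset.sum_image (f := fun F => ∑ ψ ∈ F.followers, χ ψ) hinj).symm
    _ ≤ ∑ F ∈ arrowMaps G r, ∑ ψ ∈ F.followers, χ ψ := by
        refine Finset.sum_le_sum_of_subset_of_nonneg (fun F hF => ?_) fun F _ _ => hnonneg F
        obtain ⟨F, hFH, rfl⟩ := Finset.mem_image.1 hF
        obtain ⟨hF, hr⟩ := mem_arrowMaps.1 hFH
        exact mem_arrowMaps.2 ⟨hs.isAlong_transfer hF, hs.numArrows_transfer.trans hr⟩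

end IsBranchShift

end BranchShift

/-! ### Generalized graph shifts -/

section Shift

variable {V : Type*} {G : SimpleGraph V}

theorem neighborSet_subgraph_eq_of_ncard_eq {S : G.Subgraph} {x : V}
    (hx : (G.neighborSet x).ncard ≠ 0)
    (h : (S.neighborSet x).ncard = (G.neighborSet x).ncard) : S.neighborSet x = G.neighborSet x :=
  Set.eq_of_subset_of_ncard_le (S.neighborSet_subset x) h.ge (Set.finite_of_ncard_ne_zero hx)

theorem mem_support_of_adj_of_isCycle {a x y : V} {c : G.Walk a a} (hc : c.IsCycle)
    (hx : x ∈ c.support) (hdeg : (G.neighborSet x).ncard = 2) (hxy : G.Adj x y) :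
    y ∈ c.support := by
  have hy : y ∈ c.toSubgraph.neighborSet x := by
    rw [neighborSet_subgraph_eq_of_ncard_eq (by omega)
      (by rw [hc.ncard_neighborSet_toSubgraph_eq_two hx, hdeg])]
    exact hxy
  exact (c.mem_verts_toSubgraph).1 (c.toSubgraph.edge_vert (SimpleGraph.Subgraph.Adj.symm hy))

theorem reachable_snd_deleteEdges {u v x : V} {q : G.Walk v u} (hq : q.IsPath) (hx : x ∈ q.support)
    (hxv : x ≠ v) : (G.deleteEdges {s(v, q.snd)}).Reachable q.snd x := by
  have hnil : ¬ q.Nil := fun h => hxv (by simpa [SimpleGraph.Walk.nil_iff_support_eq.1 h] using hx)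
  have hsupp : q.support = v :: q.tail.support := (q.cons_support_tail hnil).symm
  have hv : v ∉ q.tail.support := (List.nodup_cons.1 (hsupp ▸ hq.support_nodup)).1
  have hx' : x ∈ q.tail.support := (List.mem_cons.1 (hsupp ▸ hx)).resolve_left hxv
  classical
  refine ((q.tail.takeUntil x hx').toDeleteEdge s(v, q.snd) fun he => hv ?_).reachable
  exact q.tail.support_takeUntil_subset_support hx'
    (SimpleGraph.Walk.fst_mem_support_of_mem_edges _ he)

section Branch

/-- The branch at `v` away from its neighbour `w`: the vertices that stay connected to `v` when the
edge `vw` is deleted, apart from `v` itself. -/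
def branch (G : SimpleGraph V) (v w : V) : Set V :=
  {y | y ≠ v ∧ (G.deleteEdges {s(v, w)}).Reachable v y}

variable {v w x y : V}

theorem mem_branch_of_adj (hx : G.Adj v x) (hw : x ≠ w) : x ∈ branch G v w :=
  ⟨hx.ne', SimpleGraph.Adj.reachable <|
    SimpleGraph.deleteEdges_adj.2 ⟨hx, fun he => hw (Sym2.congr_right.1 he)⟩⟩

theorem mem_branch_of_mem_of_adj (hx : x ∈ branch G v w) (hy : y ≠ v) (hxy : G.Adj x y) :
    y ∈ branch G v w := by
  refine ⟨hy, hx.2.trans <| SimpleGraph.Adj.reachable <|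
    SimpleGraph.deleteEdges_adj.2 ⟨hxy, fun he => ?_⟩⟩
  have hv : v ∈ s(x, y) := (Set.mem_singleton_iff.1 he).symm ▸ Sym2.mem_mk_left v w
  exact (Sym2.mem_iff.1 hv).elim (hx.1 ·.symm) (hy ·.symm)

end Branch

section PathReversal

variable {u v : V} {q : G.Walk v u} (hq : q.IsPath)
include hq

theorem injective_getVert : Function.Injective fun i : Fin (q.length + 1) => q.getVert i :=
  fun i j hij => Fin.ext (hq.getVert_injOn (Nat.le_of_lt_succ i.2) (Nat.le_of_lt_succ j.2) hij)

open Classical in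
/-- The permutation that turns the path `q` around and fixes all vertices off `q`. -/
def pathReversal : Equiv.Perm V :=
  Fin.revPerm.extendDomain (Equiv.ofInjective _ (injective_getVert hq))

theorem pathReversal_getVert {i : ℕ} (hi : i ≤ q.length) :
    pathReversal hq (q.getVert i) = q.getVert (q.length - i) := by
  classical
  have h := Equiv.Perm.extendDomain_apply_image Fin.revPerm
    (Equiv.ofInjective _ (injective_getVert hq)) ⟨i, Nat.lt_succ_of_le hi⟩
  simpa only [pathReversal, Equiv.ofInjective_apply, Fin.revPerm_apply, Fin.val_rev,
    Nat.add_sub_add_right] using h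

theorem pathReversal_of_notMem {x : V} (hx : x ∉ q.support) : pathReversal hq x = x := by
  classical
  refine Equiv.Perm.extendDomain_apply_not_subtype _ _ ?_
  rintro ⟨i, rfl⟩
  exact hx (q.getVert_mem_support i)

theorem pathReversal_mem_support {x : V} (hx : x ∈ q.support) :
    pathReversal hq x ∈ q.support := by
  obtain ⟨i, rfl, hi⟩ := SimpleGraph.Walk.mem_support_iff_exists_getVert.1 hx
  rw [pathReversal_getVert hq hi]
  exact q.getVert_mem_support _

theorem involutive_pathReversal : Function.Involutive (pathReversal hq) := by
  intro x
  by_cases hx : x ∈ q.support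
  · obtain ⟨i, rfl, hi⟩ := SimpleGraph.Walk.mem_support_iff_exists_getVert.1 hx
    rw [pathReversal_getVert hq hi, pathReversal_getVert hq (Nat.sub_le _ _), Nat.sub_sub_self hi]
  · rw [pathReversal_of_notMem hq hx, pathReversal_of_notMem hq hx]

end PathReversal

theorem adj_or_eq_of_moveNeighbors_adj {u v w x y : V} (h : (G.moveNeighbors u v w).Adj x y) :
    (G.Adj x y ∧ ¬ ∃ z ∈ G.neighborSet v \ {w}, s(x, y) = s(v, z)) ∨
      ∃ z ∈ G.neighborSet v \ {w}, s(x, y) = s(u, z) := by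
  rw [SimpleGraph.moveNeighbors, SimpleGraph.fromEdgeSet_adj] at h
  exact h.1

/-- A path along which a generalized graph shift can be performed. It is directed from the donor `v`
to the recipient `u`, so that the neighbour of `v` that is not moved is `q.snd`. -/
structure IsShiftPath {u v : V} (q : G.Walk v u) : Prop where
  ne : u ≠ v
  isPath : q.IsPath
  ncard_eq_two : ∀ x ∈ q.support, x ≠ u → x ≠ v → (G.neighborSet x).ncard = 2
  no_cycle : ∀ (a : V) (c : G.Walk a a), c.IsCycle → ¬ (u ∈ c.support ∧ v ∈ c.support)

namespace IsShiftPath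

variable {u v : V} {q : G.Walk v u} (hs : IsShiftPath q)
include hs

theorem not_nil : ¬ q.Nil := fun h => hs.ne h.eq.symm

theorem ncard_neighborSet_getVert_succ {i : ℕ} (hi : i + 1 < q.length) :
    (G.neighborSet (q.getVert (i + 1))).ncard = 2 :=
  hs.ncard_eq_two _ (q.getVert_mem_support _)
    (fun h => hi.ne ((hs.isPath.getVert_eq_end_iff hi.le).1 h))
    fun h => i.succ_ne_zero ((hs.isPath.getVert_eq_start_iff hi.le).1 h)

theorem neighborSet_getVert_succ {i : ℕ} (hi : i + 1 < q.length) :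
    G.neighborSet (q.getVert (i + 1)) = {q.getVert i, q.getVert (i + 2)} := by
  have hdeg := hs.ncard_neighborSet_getVert_succ hi
  have h := hs.isPath.ncard_neighborSet_toSubgraph_internal_eq_two i.succ_ne_zero hi
  rw [← neighborSet_subgraph_eq_of_ncard_eq (hdeg ▸ two_ne_zero) (h.trans hdeg.symm),
    hs.isPath.neighborSet_toSubgraph_internal i.succ_ne_zero hi]
  rfl

-- A cycle through `v` and its neighbour on the path would follow the path all the way to `u`.
theorem isBridge : G.IsBridge s(v, q.snd) := by
  rw [SimpleGraph.isBridge_iff_forall_cycle_notMem (G.mem_edgeSet.2 (q.adj_snd hs.not_nil))]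
  intro a c hc he
  have hmem (i : ℕ) : i + 1 ≤ q.length → q.getVert (i + 1) ∈ c.support := by
    induction i with
    | zero => exact fun _ => c.snd_mem_support_of_mem_edges he
    | succ i ih =>
      exact fun hi => mem_support_of_adj_of_isCycle hc (ih (by omega))
        (hs.ncard_neighborSet_getVert_succ hi) (q.adj_getVert_succ hi)
  have hlen : q.length - 1 + 1 = q.length :=
    Nat.sub_add_cancel (SimpleGraph.Walk.not_nil_iff_lt_length.1 hs.not_nil)
  have hu := hmem (q.length - 1) hlen.le
  rw [hlen, q.getVert_length] at hu
  exact hs.no_cycle a c hc ⟨hu, c.fst_mem_support_of_mem_edges he⟩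

theorem notMem_branch {x : V} (hx : x ∈ q.support) : x ∉ branch G v q.snd := fun ⟨hxv, hreach⟩ =>
  SimpleGraph.isBridge_iff.1 hs.isBridge
    (hreach.trans (reachable_snd_deleteEdges hs.isPath hx hxv).symm)

theorem eq_succ_of_adj {i j : ℕ} (hij : i < j) (hj : j ≤ q.length)
    (hadj : G.Adj (q.getVert i) (q.getVert j)) : j = i + 1 := by
  have hinj {k : ℕ} (hk : k ≤ q.length) (h : q.getVert j = q.getVert k) : j = k :=
    hs.isPath.getVert_injOn hj hk h
  rcases i with - | i
  · by_contra hne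
    refine hs.notMem_branch (q.getVert_mem_support j) (mem_branch_of_adj ?_ fun h => hne ?_)
    · rwa [q.getVert_zero] at hadj
    · exact hinj (by omega) h
  · rw [← SimpleGraph.mem_neighborSet, hs.neighborSet_getVert_succ (by omega)] at hadj
    rcases hadj with h | h
    · have := hinj (by omega) h
      omega
    · exact hinj (by omega) h

theorem adj_pathReversal {x y : V} (hx : x ∈ q.support) (hy : y ∈ q.support) (hxy : G.Adj x y) :
    G.Adj (pathReversal hs.isPath x) (pathReversal hs.isPath y) := by
  obtain ⟨i, rfl, hi⟩ := SimpleGraph.Walk.mem_support_iff_exists_getVert.1 hx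
  obtain ⟨j, rfl, hj⟩ := SimpleGraph.Walk.mem_support_iff_exists_getVert.1 hy
  wlog hij : i < j generalizing i j
  · have hne : i ≠ j := fun h => hxy.ne (h ▸ rfl)
    exact (this j hj hy i hi hx hxy.symm (by omega)).symm
  obtain rfl := hs.eq_succ_of_adj hij hj hxy
  have hlen : q.length - i = q.length - (i + 1) + 1 := by omega
  rw [pathReversal_getVert _ hi, pathReversal_getVert _ hj, hlen]
  exact (q.adj_getVert_succ (by omega)).symm

theorem eq_or_of_adj_of_notMem_support {x y : V} (hx : x ∈ q.support) (hy : y ∉ q.support)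
    (hxy : G.Adj x y) :
    (x = u ∧ y ∉ branch G v q.snd) ∨ (x = v ∧ y ∈ branch G v q.snd) := by
  obtain ⟨i, rfl, hi⟩ := SimpleGraph.Walk.mem_support_iff_exists_getVert.1 hx
  rcases i with - | i
  · rw [q.getVert_zero] at hxy ⊢
    exact .inr ⟨rfl, mem_branch_of_adj hxy fun h => hy (h ▸ q.getVert_mem_support 1)⟩
  rcases hi.lt_or_eq with hi | hi
  · rw [← SimpleGraph.mem_neighborSet, hs.neighborSet_getVert_succ hi] at hxy
    rcases hxy with rfl | rfl <;> exact absurd (q.getVert_mem_support _) hy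
  · rw [hi, q.getVert_length] at hxy ⊢
    exact .inl ⟨rfl, fun hyY => hs.notMem_branch q.end_mem_support
      (mem_branch_of_mem_of_adj hyY hs.ne hxy.symm)⟩

theorem adj_of_moveNeighbors_adj {x y : V} (hY : x ∈ branch G v q.snd ↔ y ∈ branch G v q.snd)
    (h : (G.moveNeighbors u v q.snd).Adj x y) : G.Adj x y := by
  rcases adj_or_eq_of_moveNeighbors_adj h with h | ⟨z, hz, he⟩
  · exact h.1
  have hu := hs.notMem_branch q.end_mem_support
  have hzY := mem_branch_of_adj hz.1 hz.2
  rcases Sym2.eq_iff.1 he with ⟨rfl, rfl⟩ | ⟨rfl, rfl⟩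
  exacts [absurd (hY.2 hzY) hu, absurd (hY.1 hzY) hu]

theorem eq_and_adj_of_moveNeighbors_adj {x y : V} (hx : x ∈ branch G v q.snd)
    (hy : y ∉ branch G v q.snd) (h : (G.moveNeighbors u v q.snd).Adj x y) :
    y = u ∧ G.Adj x v := by
  rcases adj_or_eq_of_moveNeighbors_adj h with ⟨hadj, hno⟩ | ⟨z, hz, he⟩
  · obtain rfl : y = v := by_contra fun hyv => hy (mem_branch_of_mem_of_adj hx hyv hadj)
    refine absurd ⟨x, ⟨hadj.symm, ?_⟩, Sym2.eq_swap⟩ hno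
    rintro rfl
    exact hs.notMem_branch (q.getVert_mem_support 1) hx
  · rcases Sym2.eq_iff.1 he with ⟨rfl, rfl⟩ | ⟨rfl, rfl⟩
    · exact absurd hx (hs.notMem_branch q.end_mem_support)
    · exact ⟨rfl, hz.1.symm⟩

theorem isBranchShift : IsBranchShift G (G.moveNeighbors u v q.snd) u v {x | x ∈ q.support}
    (branch G v q.snd) (pathReversal hs.isPath) where
  ne := hs.ne
  left_mem := q.end_mem_support
  disjoint := Set.disjoint_left.2 fun _ => hs.notMem_branch
  involutive := involutive_pathReversal _
  map_left := by
    simpa only [q.getVert_length, Nat.sub_self, q.getVert_zero] using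
      pathReversal_getVert hs.isPath le_rfl
  map_mem _ := pathReversal_mem_support _
  map_eq _ := pathReversal_of_notMem _
  adj_map _ hi _ := hs.adj_pathReversal hi
  adj_leave _ hi _ := hs.eq_or_of_adj_of_notMem_support hi
  adj_of_mem_iff _ _ := hs.adj_of_moveNeighbors_adj
  adj_cross _ hi _ := hs.eq_and_adj_of_moveNeighbors_adj hi

end IsShiftPath

theorem exists_isBranchShift_of_isGGS {H : SimpleGraph V} (h : G.IsGGS H) :
    ∃ u v P Y ρ, IsBranchShift G H u v P Y ρ := by
  obtain ⟨u, v, p, hne, hp, hdeg, hcyc, rfl⟩ := h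
  have hs : IsShiftPath p.reverse :=
    ⟨hne, hp.reverse, by simpa only [SimpleGraph.Walk.support_reverse, List.mem_reverse] using hdeg,
      hcyc⟩
  rw [← p.snd_reverse]
  exact ⟨u, v, _, _, _, hs.isBranchShift⟩

end Shift

section Immanant

variable {n : ℕ} {G H : SimpleGraph (Fin n)}

theorem lapImmCoeff_eq_sum_arrowMaps [DecidableRel G.Adj] (hG : G.IsBipartite) (lam : n.Partition)
    {r : ℕ} (hr : r ≤ n) :
    lapImmCoeff lam r G = ∑ F ∈ arrowMaps G r, ∑ ψ ∈ F.followers, symChar lam ψ := by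
  have hpoly : lapImmPoly lam G = ∑ σ : Equiv.Perm (Fin n),
      C (symChar lam σ) * ∏ i, (G.lapMatrix ℂ).charmatrix i (σ i) := by
    simp only [lapImmPoly, immanant, Matrix.charmatrix, Matrix.scalar_apply,
      ← Matrix.smul_one_eq_diagonal]
    rfl
  have h := sum_mul_coeff_prod_charmatrix_lapMatrix ℂ hG (symChar lam) (r := r) (by simpa using hr)
  rw [Fintype.card_fin] at h
  rw [lapImmCoeff, hpoly, finsetSum_coeff]
  simp only [coeff_C_mul]
  rw [h, ← mul_assoc, ← mul_pow, neg_one_mul, neg_neg, one_pow, one_mul]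

open scoped ComplexOrder

theorem sum_symChar_followers_nonneg (lam : n.Partition) (F : ArrowMap (Fin n)) :
    0 ≤ ∑ ψ ∈ F.followers, symChar lam ψ :=
  F.sum_character_followers_nonneg (specht lam).toRepresentation

theorem exists_nat_lapImmCoeff [DecidableRel G.Adj] (hG : G.IsBipartite) (lam : n.Partition)
    {r : ℕ} (hr : r ≤ n) : ∃ b : ℕ, lapImmCoeff lam r G = b := by
  choose z hz using exists_int_symChar lam
  rw [lapImmCoeff_eq_sum_arrowMaps hG lam hr]
  have hcast : ∑ F ∈ arrowMaps G r, ∑ ψ ∈ F.followers, symChar lam ψ =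
      ((∑ F ∈ arrowMaps G r, ∑ ψ ∈ F.followers, z ψ : ℤ) : ℂ) := by
    simp only [hz, Int.cast_sum]
  have hnonneg : 0 ≤ ∑ F ∈ arrowMaps G r, ∑ ψ ∈ F.followers, z ψ := by
    have : 0 ≤ ∑ F ∈ arrowMaps G r, ∑ ψ ∈ F.followers, symChar lam ψ :=
      Finset.sum_nonneg fun F _ => sum_symChar_followers_nonneg lam F
    exact_mod_cast hcast ▸ this
  obtain ⟨b, hb⟩ := Int.eq_ofNat_of_zero_le hnonneg
  exact ⟨b, by rw [hcast, hb, Int.cast_natCast]⟩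

theorem IsBranchShift.lapImmCoeff_le [DecidableRel G.Adj] [DecidableRel H.Adj] {u v : Fin n}
    {P Y : Set (Fin n)} {ρ : Equiv.Perm (Fin n)} (hs : IsBranchShift G H u v P Y ρ)
    (hG : G.IsBipartite) (lam : n.Partition) {r : ℕ} (hr : r ≤ n) :
    lapImmCoeff lam r H ≤ lapImmCoeff lam r G := by
  rw [lapImmCoeff_eq_sum_arrowMaps hG lam hr,
    lapImmCoeff_eq_sum_arrowMaps (hs.isBipartite hG) lam hr]
  exact hs.sum_arrowMaps_le (fun _ _ h => character_eq_of_isConj _ h)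
    (sum_symChar_followers_nonneg lam) r

end Immanant

end

theorem theorem1p2 {n : ℕ} (G : SimpleGraph (Fin n)) [DecidableRel G.Adj] (hG : G.IsBipartite)
    (lam : n.Partition) (r : ℕ) (hr : r ≤ n) :
    (∃ b : ℕ, lapImmCoeff lam r G = b) ∧
      ∀ (H : SimpleGraph (Fin n)) [DecidableRel H.Adj], G.IsGGS H →
        ∃ b b' : ℕ, lapImmCoeff lam r G = b ∧ lapImmCoeff lam r H = b' ∧ b' ≤ b := by
  obtain ⟨b, hb⟩ := exists_nat_lapImmCoeff hG lam hr
  refine ⟨⟨b, hb⟩, fun H _ hGGS => ?_⟩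
  obtain ⟨u, v, P, Y, ρ, hs⟩ := exists_isBranchShift_of_isGGS hGGS
  obtain ⟨b', hb'⟩ := exists_nat_lapImmCoeff (hs.isBipartite hG) lam hr
  refine ⟨b, b', hb, hb', ?_⟩
  have hle := hs.lapImmCoeff_le hG lam hr
  rw [hb, hb'] at hle
  open scoped ComplexOrder in exact_mod_cast hle
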